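/- **Theorem.** *Burning.* A graph $G$ is burned in rounds. Initially no vertex is burned. In each round $t\ge1$ one vertex that is still unburned at the end of round $t-1$ is chosen and becomes burned, and at the same time every neighbour of a vertex that was burned by the end of round $t-1$ becomes burned; burned vertices stay burned. The burning number $b(G)$ is the least $k$ such that all vertices of $G$ can be burned in at most $k$ rounds. *The graphs.* For integers $g\ge3$ and $a_1\ge a_2\ge1$, let $U_g^{a_1,a_2}$ be the graph of order $n=g+a_1+a_2$ obtained from a cycle $C_g$ by attaching two pendant paths, with $a_1$ and $a_2$ new vertices, at one and the same vertex of the cycle. *The exceptional families.* For integers $q,r$ define the following sets of triples $(g,a_1,a_2)$, where $n=g+a_1+a_2$: $\mathcal B=\{(2q-2,q^2-q-2,q+1),\ (2q-1,q^2-q-2,q+1)\}$; $B_1=\{(q^2-2,q,q),\ (q^2-6,q+2,q+2),\ (q^2-10,q+4,q+4),\ (q^2-3,q+1,q),\ (q^2-5,q+3,q),\ (q^2-7,q+3,q+2),\ (q^2-8,q+3,q+3),\ (q^2-7,q+5,q),\ (q^2-10,q+5,q+3),\ (q^2-11,q+5,q+4),\ (q^2-12,q+5,q+5),\ (q^2-14,q+6,q+6),\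 (q^2-12,q+7,q+3),\ (q^2-14,q+7,q+5),\ (q^2-14,q+9,q+3)\}$; $B_2=\{(2q,q^2-q-2,q),\ (2q+2,q^2-q-6,q+2),\ (2q+4,q^2-q-10,q+4),\ (2q+1,q^2-q-3,q),\ (2q+3,q^2-q-5,q),\ (2q+3,q^2-q-7,q+2),\ (2q+3,q^2-q-8,q+3),\ (2q+5,q^2-q-7,q),\ (2q+5,q^2-q-10,q+3),\ (2q+5,q^2-q-11,q+4),\ (2q+5,q^2-q-12,q+5),\ (2q+6,q^2-q-14,q+6),\ (2q+7,q^2-q-12,q+3),\ (2q+7,q^2-q-14,q+5),\ (2q+9,q^2-q-14,q+3)\}$; $B_3=\{(2q,q^2-q-3,q+1),\ (2q,q^2-q-5,q+3),\ (2q+2,q^2-q-7,q+3),\ (2q,q^2-q-7,q+5),\ (2q+3,q^2-q-10,q+5),\ (2q+4,q^2-q-11,q+5),\ (2q+3,q^2-q-12,q+7),\ (2q+5,q^2-q-14,q+7),\ (2q+3,q^2-q-14,q+9)\}$; $B_4=\{(24,16,6),\ (22,16,8),\ (35,19,7),\ (32,19,10),\ (30,19,12),\ (28,19,14),\ (26,19,16),\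 (30,21,10),\ (28,21,12),\ (45,22,11),\ (43,22,13),\ (41,22,15),\ (34,22,22),\ (43,24,11),\ (41,24,13),\ (32,24,22),\ (41,26,11),\ (60,25,12),\ (58,25,14),\ (47,25,25),\ (58,27,12),\ (47,38,12),\ (77,28,13)\}$; $B_5=\{(22,18,6),\ (22,16,8),\ (26,28,7),\ (26,25,10),\ (26,23,12),\ (26,21,14),\ (26,19,16),\ (28,23,10),\ (28,21,12),\ (30,37,11),\ (30,35,13),\ (30,33,15),\ (30,26,22),\ (32,35,11),\ (32,33,13),\ (32,24,22),\ (34,33,11),\ (34,51,12),\ (34,49,14),\ (34,38,25),\ (36,49,12),\ (47,38,12),\ (38,67,13)\}$; $B_6=\{(12,18,16),\ (14,16,16),\ (14,28,19),\ (17,25,19),\ (19,23,19),\ (21,21,19),\ (23,19,19),\ (17,23,21),\ (19,21,21),\ (19,37,22),\ (21,35,22),\ (23,33,22),\ (30,26,22),\ (19,35,24),\ (21,33,24),\ (30,24,24),\ (19,33,26),\ (21,51,25),\ (23,49,25),\ (34,38,25),\ (21,49,27),\ (21,38,38),\ (23,67,28)\}$; $\mathcal C_1=\{(2q+1,q^2-q-2,r-q+1),\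 (q^2-2,q+1,r-q+1)\}$; $\mathcal C_2=\{(q^2-7,q+2,q+1),\ (2q+1,q^2-q-6,q+1),\ (2q+1,q^2-q-7,q+2)\}$; $\mathcal C_3=\{(q^2-3,q,q),\ (q^2-5,q+1,q+1),\ (q^2-6,q+2,q+1),\ (q^2-7,q+2,q+2),\ (q^2-7,q+3,q+1),\ (q^2-11,q+4,q+4),\ (2q+4,q^2-q-11,q+4),\ (2q+1,q^2-q-5,q+1),\ (2q+1,q^2-q-6,q+2),\ (2q+1,q^2-q-7,q+3),\ (2q+2,q^2-q-6,q+1),\ (2q+2,q^2-q-7,q+2),\ (2q+3,q^2-q-7,q+1),\ (2q,q^2-q-3,q),\ (22,16,7),\ (13,16,16)\}$; $\mathcal C_4=\{(g,a_1,a_2): n=q^2+2q-2,\ g-q\ge a_1\ge a_2=q+1\}\cup B_1\cup B_4$; $\mathcal C_5=\{(g,a_1,a_2): n=q^2+2q-2,\ a_1\ge g-q\ge a_2=q+1\}\cup B_2\cup B_5$; $\mathcal C_6=\{(g,a_1,a_2): n=q^2+2q-2,\ a_1\ge a_2\ge g-q=q+1\}\cup B_3\cup B_6$. *Statement.* Let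 $g\ge3$, $a_1\ge a_2\ge1$ and suppose that $n=g+a_1+a_2=q^2+r$ with $1\le r\le 2q-2$. Assume that one of the following holds: 1. $r+1\le g\le 2q-1$, $a_1\le q^2-\lfloor g/2\rfloor-1$ and $(g,a_1,a_2)\notin\mathcal B$; 2. $2q\le g\le q^2$, $a_2\ge r-q+1$ and $(g,a_1,a_2)\notin\bigcup_{i=1}^6\mathcal C_i$. Then $b(U_g^{a_1,a_2})=\lceil\sqrt n\,\rceil-1=q$. -/

import Mathlib

/-- `BurnsTo G t B`: some run of the burning process on `G` has burned exactly the vertices in `B`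
at the end of round `t`.  In each round one vertex `x` that is still unburned is set on fire, while
the fire spreads from every vertex burned earlier to all of its neighbours. -/
inductive BurnsTo {V : Type*} (G : SimpleGraph V) : ℕ → Set V → Prop
  | start : BurnsTo G 0 ∅
  | round {t : ℕ} {B : Set V} (h : BurnsTo G t B) (x : V) (hx : x ∉ B) :
      BurnsTo G (t + 1) (B ∪ {v | ∃ u ∈ B, G.Adj u v} ∪ {x})

/-- `G` can be burned completely in at most `k` rounds. -/
def IsBurnable {V : Type*} (G : SimpleGraph V) (k : ℕ) : Prop :=
  ∃ t ≤ k, BurnsTo G t Set.univ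

/-- The least `k` such that `G` is `k`-burnable. -/
noncomputable def burningNumber {V : Type*} (G : SimpleGraph V) : ℕ :=
  sInf {k | IsBurnable G k}

/-- The graph obtained from the cycle `C_g` (vertices `Sum.inl i`) by attaching at one of its
vertices, `Sum.inl 0`, two paths with `a₁` and `a₂` new vertices.  The new vertex at
distance `j + 1` from the cycle is `Sum.inr (Sum.inl j)`, respectively `Sum.inr (Sum.inr j)`. -/
def unicyclicGraph (g a₁ a₂ : ℕ) : SimpleGraph (Fin g ⊕ Fin a₁ ⊕ Fin a₂) :=
  SimpleGraph.fromRel fun x y =>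
    match x, y with
    | .inl i, .inl j => (SimpleGraph.cycleGraph g).Adj i j
    | .inl i, .inr (.inl j) => i.val = 0 ∧ j.val = 0
    | .inl i, .inr (.inr j) => i.val = 0 ∧ j.val = 0
    | .inr (.inl i), .inr (.inl j) => (SimpleGraph.pathGraph a₁).Adj i j
    | .inr (.inr i), .inr (.inr j) => (SimpleGraph.pathGraph a₂).Adj i j
    | _, _ => False

/-! The exceptional sets of triples `(g, a₁, a₂)`. -/

def exceptB (q : ℤ) : Set (ℤ × ℤ × ℤ) :=
  {(2 * q - 2, q ^ 2 - q - 2, q + 1), (2 * q - 1, q ^ 2 - q - 2, q + 1)}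

def exceptB1 (q : ℤ) : Set (ℤ × ℤ × ℤ) :=
  {(q ^ 2 - 2, q, q), (q ^ 2 - 6, q + 2, q + 2), (q ^ 2 - 10, q + 4, q + 4),
   (q ^ 2 - 3, q + 1, q), (q ^ 2 - 5, q + 3, q), (q ^ 2 - 7, q + 3, q + 2),
   (q ^ 2 - 8, q + 3, q + 3), (q ^ 2 - 7, q + 5, q), (q ^ 2 - 10, q + 5, q + 3),
   (q ^ 2 - 11, q + 5, q + 4), (q ^ 2 - 12, q + 5, q + 5), (q ^ 2 - 14, q + 6, q + 6),
   (q ^ 2 - 12, q + 7, q + 3), (q ^ 2 - 14, q + 7, q + 5), (q ^ 2 - 14, q + 9, q + 3)}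

def exceptB2 (q : ℤ) : Set (ℤ × ℤ × ℤ) :=
  {(2 * q, q ^ 2 - q - 2, q), (2 * q + 2, q ^ 2 - q - 6, q + 2),
   (2 * q + 4, q ^ 2 - q - 10, q + 4), (2 * q + 1, q ^ 2 - q - 3, q),
   (2 * q + 3, q ^ 2 - q - 5, q), (2 * q + 3, q ^ 2 - q - 7, q + 2),
   (2 * q + 3, q ^ 2 - q - 8, q + 3), (2 * q + 5, q ^ 2 - q - 7, q),
   (2 * q + 5, q ^ 2 - q - 10, q + 3), (2 * q + 5, q ^ 2 - q - 11, q + 4),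
   (2 * q + 5, q ^ 2 - q - 12, q + 5), (2 * q + 6, q ^ 2 - q - 14, q + 6),
   (2 * q + 7, q ^ 2 - q - 12, q + 3), (2 * q + 7, q ^ 2 - q - 14, q + 5),
   (2 * q + 9, q ^ 2 - q - 14, q + 3)}

def exceptB3 (q : ℤ) : Set (ℤ × ℤ × ℤ) :=
  {(2 * q, q ^ 2 - q - 3, q + 1), (2 * q, q ^ 2 - q - 5, q + 3),
   (2 * q + 2, q ^ 2 - q - 7, q + 3), (2 * q, q ^ 2 - q - 7, q + 5),
   (2 * q + 3, q ^ 2 - q - 10, q + 5), (2 * q + 4, q ^ 2 - q - 11, q + 5),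
   (2 * q + 3, q ^ 2 - q - 12, q + 7), (2 * q + 5, q ^ 2 - q - 14, q + 7),
   (2 * q + 3, q ^ 2 - q - 14, q + 9)}

def exceptB4 : Set (ℤ × ℤ × ℤ) :=
  {(24, 16, 6), (22, 16, 8), (35, 19, 7), (32, 19, 10), (30, 19, 12), (28, 19, 14), (26, 19, 16),
   (30, 21, 10), (28, 21, 12), (45, 22, 11), (43, 22, 13), (41, 22, 15), (34, 22, 22),
   (43, 24, 11), (41, 24, 13), (32, 24, 22), (41, 26, 11), (60, 25, 12), (58, 25, 14),
   (47, 25, 25), (58, 27, 12), (47, 38, 12), (77, 28, 13)}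

def exceptB5 : Set (ℤ × ℤ × ℤ) :=
  {(22, 18, 6), (22, 16, 8), (26, 28, 7), (26, 25, 10), (26, 23, 12), (26, 21, 14), (26, 19, 16),
   (28, 23, 10), (28, 21, 12), (30, 37, 11), (30, 35, 13), (30, 33, 15), (30, 26, 22),
   (32, 35, 11), (32, 33, 13), (32, 24, 22), (34, 33, 11), (34, 51, 12), (34, 49, 14),
   (34, 38, 25), (36, 49, 12), (47, 38, 12), (38, 67, 13)}

def exceptB6 : Set (ℤ × ℤ × ℤ) :=
  {(12, 18, 16), (14, 16, 16), (14, 28, 19), (17, 25, 19), (19, 23, 19), (21, 21, 19),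
   (23, 19, 19), (17, 23, 21), (19, 21, 21), (19, 37, 22), (21, 35, 22), (23, 33, 22),
   (30, 26, 22), (19, 35, 24), (21, 33, 24), (30, 24, 24), (19, 33, 26), (21, 51, 25),
   (23, 49, 25), (34, 38, 25), (21, 49, 27), (21, 38, 38), (23, 67, 28)}

def exceptC1 (q r : ℤ) : Set (ℤ × ℤ × ℤ) :=
  {(2 * q + 1, q ^ 2 - q - 2, r - q + 1), (q ^ 2 - 2, q + 1, r - q + 1)}

def exceptC2 (q : ℤ) : Set (ℤ × ℤ × ℤ) :=
  {(q ^ 2 - 7, q + 2, q + 1), (2 * q + 1, q ^ 2 - q - 6, q + 1),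
   (2 * q + 1, q ^ 2 - q - 7, q + 2)}

def exceptC3 (q : ℤ) : Set (ℤ × ℤ × ℤ) :=
  {(q ^ 2 - 3, q, q), (q ^ 2 - 5, q + 1, q + 1), (q ^ 2 - 6, q + 2, q + 1),
   (q ^ 2 - 7, q + 2, q + 2), (q ^ 2 - 7, q + 3, q + 1), (q ^ 2 - 11, q + 4, q + 4),
   (2 * q + 4, q ^ 2 - q - 11, q + 4), (2 * q + 1, q ^ 2 - q - 5, q + 1),
   (2 * q + 1, q ^ 2 - q - 6, q + 2), (2 * q + 1, q ^ 2 - q - 7, q + 3),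
   (2 * q + 2, q ^ 2 - q - 6, q + 1), (2 * q + 2, q ^ 2 - q - 7, q + 2),
   (2 * q + 3, q ^ 2 - q - 7, q + 1), (2 * q, q ^ 2 - q - 3, q), (22, 16, 7), (13, 16, 16)}

def exceptC4 (q : ℤ) : Set (ℤ × ℤ × ℤ) :=
  {(g, a₁, a₂) : ℤ × ℤ × ℤ | g + a₁ + a₂ = q ^ 2 + 2 * q - 2 ∧
    g - q ≥ a₁ ∧ a₁ ≥ a₂ ∧ a₂ = q + 1} ∪ exceptB1 q ∪ exceptB4

def exceptC5 (q : ℤ) : Set (ℤ × ℤ × ℤ) :=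
  {(g, a₁, a₂) : ℤ × ℤ × ℤ | g + a₁ + a₂ = q ^ 2 + 2 * q - 2 ∧
    a₁ ≥ g - q ∧ g - q ≥ a₂ ∧ a₂ = q + 1} ∪ exceptB2 q ∪ exceptB5

def exceptC6 (q : ℤ) : Set (ℤ × ℤ × ℤ) :=
  {(g, a₁, a₂) : ℤ × ℤ × ℤ | g + a₁ + a₂ = q ^ 2 + 2 * q - 2 ∧
    a₁ ≥ a₂ ∧ a₂ ≥ g - q ∧ g - q = q + 1} ∪ exceptB3 q ∪ exceptB6

def exceptC (q r : ℤ) : Set (ℤ × ℤ × ℤ) :=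
  exceptC1 q r ∪ exceptC2 q ∪ exceptC3 q ∪ exceptC4 q ∪ exceptC5 q ∪ exceptC6 q

/-! Write q = m + 1, and call the vertex where cycle and paths meet the hub.

Lower bound: all vertices have degree at most 2, except the hub, of degree at most 4. Hence the
frontier of the burned set grows by at most 2 per round, plus 2 once when the hub burns. After t
rounds at most t² + 2t < (t + 1)² vertices are burned (`BurnsTo.card_le`), while n ≥ q².

Upper bound: it suffices to cover the graph by balls of radii 0, …, m (`isBurnable_of_near`). The
ball of radius m goes at distance d from the hub on the longer arm. What it misses is three paths,
on which the ball of radius i serves as a subpath with 2i + 1 vertices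
(`unicyclicGraph.isBurnable_of_coverable`). The question becomes whether three paths of total length
at most m² = 1 + 3 + … + (2m - 1) can be covered by subpaths of these lengths.
`coverable_of_not_exceptional` says yes outside an explicit list: for m ≥ 11, remove the longest
subpath from the longest path and induct; smaller m are a finite check.

For d = 0 the listed triples translate into the excluded families, up to a few that d = 1 repairs.
For a short cycle, d is chosen so that the cycle is swallowed whole and at most two paths remain. -/

/-! ### Covering three paths by subpaths of odd lengths -/

/-- Three paths with `x`, `y`, `z` vertices can be covered by `m` subpaths with
`1, 3, …, 2 * m - 1` vertices. -/
def Coverable : ℕ → ℕ → ℕ → ℕ → Prop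
  | 0, x, y, z => x = 0 ∧ y = 0 ∧ z = 0
  | m + 1, x, y, z => Coverable m (x - (2 * m + 1)) y z ∨ Coverable m x (y - (2 * m + 1)) z ∨
      Coverable m x y (z - (2 * m + 1))

/-- A search procedure for `Coverable`, cutting branches in which the paths are too long. -/
def coverSearch : ℕ → ℕ → ℕ → ℕ → Bool
  | 0, x, y, z => Nat.beq (x + y + z) 0
  | m + 1, x, y, z => Nat.ble (x + y + z) ((m + 1) * (m + 1)) &&
      (coverSearch m (x - (2 * m + 1)) y z || coverSearch m x (y - (2 * m + 1)) z ||
        coverSearch m x y (z - (2 * m + 1)))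

theorem Coverable.of_coverSearch {m x y z : ℕ} (h : coverSearch m x y z = true) :
    Coverable m x y z := by
  induction m generalizing x y z with
  | zero =>
    have := Nat.eq_of_beq_eq_true h
    exact ⟨by omega, by omega, by omega⟩
  | succ m ih =>
    simp only [coverSearch, Bool.and_eq_true, Bool.or_eq_true] at h
    obtain ⟨-, (h | h) | h⟩ := h
    · exact Or.inl (ih h)
    · exact Or.inr (Or.inl (ih h))
    · exact Or.inr (Or.inr (ih h))

theorem Coverable.swap {m x y z : ℕ} (h : Coverable m x y z) : Coverable m y x z := by
  induction m generalizing x y z with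
  | zero => exact ⟨h.2.1, h.1, h.2.2⟩
  | succ m ih =>
    rcases h with h | h | h
    · exact Or.inr (Or.inl (ih h))
    · exact Or.inl (ih h)
    · exact Or.inr (Or.inr (ih h))

theorem Coverable.rotate {m x y z : ℕ} (h : Coverable m x y z) : Coverable m y z x := by
  induction m generalizing x y z with
  | zero => exact ⟨h.2.1, h.2.2, h.1⟩
  | succ m ih =>
    rcases h with h | h | h
    · exact Or.inr (Or.inr (ih h))
    · exact Or.inl (ih h)
    · exact Or.inr (Or.inl (ih h))

theorem Coverable.mono {m x y z x' : ℕ} (h : Coverable m x y z) (hx : x' ≤ x) :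
    Coverable m x' y z := by
  induction m generalizing x y z x' with
  | zero => exact ⟨by have := h.1; omega, h.2.1, h.2.2⟩
  | succ m ih =>
    rcases h with h | h | h
    · exact Or.inl (ih h (by omega))
    · exact Or.inr (Or.inl (ih h hx))
    · exact Or.inr (Or.inr (ih h hx))

/-- `PairExceptional s y z`: two short paths with `y` and `z` vertices that cannot be completed by a
third path to a coverable triple missing the maximal total length by `s`. -/
def PairExceptional (s y z : ℕ) : Prop :=
  (s, y, z) ∈ [(0, 2, 0), (0, 1, 1), (0, 3, 3), (0, 5, 5), (0, 2, 1), (0, 4, 1), (0, 4, 3),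
    (0, 4, 4), (0, 6, 1), (0, 6, 4), (0, 6, 5), (0, 6, 6), (0, 7, 7), (0, 8, 4), (0, 8, 6),
    (0, 10, 4), (1, 1, 1), (1, 2, 2), (1, 3, 2), (1, 3, 3), (1, 4, 2), (1, 5, 5), (2, 3, 2),
    (2, 2, 2), (3, 2, 2)]

instance (s y z : ℕ) : Decidable (PairExceptional s y z) := by
  unfold PairExceptional; infer_instance

/-- The triples of path lengths that are not coverable and belong to no infinite family. -/
def SporadicExceptional (m x y z : ℕ) : Prop :=
  (m, x, y, z) ∈ [(5, 11, 11, 2), (5, 11, 11, 3), (5, 13, 11, 1), (6, 13, 13, 10), (6, 15, 13, 8),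
    (6, 15, 15, 6), (6, 17, 13, 6), (6, 17, 15, 4), (6, 19, 13, 4), (6, 22, 13, 1),
    (7, 17, 17, 15), (7, 19, 15, 15), (7, 26, 15, 8), (7, 26, 17, 6), (7, 26, 19, 4),
    (7, 28, 15, 6), (7, 28, 17, 4), (7, 30, 15, 4), (8, 30, 17, 17), (8, 30, 30, 4),
    (8, 41, 17, 6), (8, 41, 19, 4), (8, 43, 17, 4), (9, 58, 19, 4)]

instance (m x y z : ℕ) : Decidable (SporadicExceptional m x y z) := by
  unfold SporadicExceptional; infer_instance

/-- The triples `x ≥ y ≥ z` of total length at most `m ^ 2` that may fail to be coverable. -/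
def Exceptional (m x y z : ℕ) : Prop :=
  (x + y + z = m ^ 2 ∧ z = 2) ∨ (∃ s < 4, x + y + z + s = m ^ 2 ∧ PairExceptional s y z) ∨
    SporadicExceptional m x y z

theorem PairExceptional.bounds {s y z : ℕ} (h : PairExceptional s y z) :
    s ≤ 3 ∧ y ≤ 10 ∧ z ≤ y := by
  simp only [PairExceptional, List.mem_cons, Prod.mk.injEq, List.not_mem_nil, or_false] at h
  omega

theorem SporadicExceptional.le_nine {m x y z : ℕ} (h : SporadicExceptional m x y z) : m ≤ 9 := by
  simp only [SporadicExceptional, List.mem_cons, Prod.mk.injEq, List.not_mem_nil, or_false] at h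
  omega

/-- Decidable form of the classification for given `m` and the two shorter lengths `y` and `z`. -/
def SmallCase (m y z : ℕ) : Prop :=
  z ≤ y → y + y + z ≤ m * m → coverSearch m (m * m - y - z) y z = true ∨
    ∀ s < 5, (s = 0 ∧ z = 2) ∨ PairExceptional s y z ∨
      SporadicExceptional m (m * m - s - y - z) y z ∨
      coverSearch m (m * m - s - y - z) y z = true ∨ m * m < y + y + z + s

instance (m y z : ℕ) : Decidable (SmallCase m y z) := by
  unfold SmallCase; infer_instance

/-- A finite check suffices because a cover of a longer path covers a shorter one: for each `y`, `z`
only total deficits s ≤ 4 matter, and no listed triple has deficit 4. The ranges of `y` and `z`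
follow from z ≤ y and 2y + z ≤ m². The last sporadic triple has m = 9, so an induction starting from
m = 10 never meets one. -/
theorem smallCase_of_lt : ∀ m < 11, ∀ z < m * m / 3 + 1, ∀ y < m * m / 2 + 1,
    SmallCase m y z := by
  decide +kernel

theorem coverable_of_lt {m x y z : ℕ} (hm : m < 11) (hzy : z ≤ y) (hyx : y ≤ x)
    (hs : x + y + z ≤ m ^ 2) (hE : ¬ Exceptional m x y z) : Coverable m x y z := by
  have hsq : m ^ 2 = m * m := pow_two m
  obtain h₀ | H := smallCase_of_lt m hm z (by omega) y (by omega) hzy (by omega)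
  · exact (Coverable.of_coverSearch h₀).mono (by omega)
  -- With deficit at least 4, `x` is lengthened until the deficit is exactly 4; otherwise the
  -- deficit is the `s` that was checked.
  by_cases h4 : x + y + z + 4 ≤ m * m
  · rcases H 4 (by norm_num) with h | h | h | h | h
    · omega
    · have := h.bounds
      omega
    · simp only [SporadicExceptional, List.mem_cons, Prod.mk.injEq, List.not_mem_nil, or_false] at h
      rcases h with h | h | h | h | h | h | h | h | h | h | h | h | h | h | h | h | h | h | h | h |
        h | h | h | h <;> obtain ⟨rfl, h, rfl, rfl⟩ := h <;> omega
    · exact (Coverable.of_coverSearch h).mono (by omega)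
    · omega
  · obtain ⟨s, hs'⟩ : ∃ s, x + y + z + s = m * m := ⟨m * m - (x + y + z), by omega⟩
    have hx : m * m - s - y - z = x := by omega
    rcases H s (by omega) with h | h | h | h | h
    · exact absurd (Or.inl ⟨by omega, h.2⟩) hE
    · exact absurd (Or.inr (Or.inl ⟨s, by omega, by omega, h⟩)) hE
    · exact absurd (Or.inr (Or.inr (hx ▸ h))) hE
    · exact hx ▸ Coverable.of_coverSearch h
    · omega

theorem coverable_of_not_exceptional {m x y z : ℕ} (hzy : z ≤ y) (hyx : y ≤ x)
    (hs : x + y + z ≤ m ^ 2) (hE : ¬ Exceptional m x y z) : Coverable m x y z := by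
  induction m generalizing x y z with
  | zero => exact coverable_of_lt (by norm_num) hzy hyx hs hE
  | succ m ih =>
    rcases Nat.lt_or_ge m 10 with hm | hm
    · exact coverable_of_lt (by omega) hzy hyx hs hE
    have hsq : (m + 1) ^ 2 = m ^ 2 + 2 * m + 1 := by ring
    have hM : 10 * m ≤ m ^ 2 := by nlinarith
    have hs' : x - (2 * m + 1) + y + z ≤ m ^ 2 := by omega
    have hz : ¬ (x + y + z = (m + 1) ^ 2 ∧ z = 2) := fun h => hE (Or.inl h)
    have hp : ∀ s, x + y + z + s = (m + 1) ^ 2 → ¬ PairExceptional s y z := fun s h h' =>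
      hE (Or.inr (Or.inl ⟨s, by have := h'.bounds; omega, h, h'⟩))
    -- The longest subpath is taken from the longest path. If the order is unchanged, an exception
    -- for `m` is one for `m + 1`, with the same `s`, `y`, `z`. If `x` becomes the middle or the
    -- shortest path, an exceptional pair would make all three paths too short for the total to be
    -- near m², as m ≥ 10; only the family z = 2 can persist, and it is excluded by `hz`.
    refine Or.inl ?_
    by_cases h₁ : y ≤ x - (2 * m + 1)
    · refine ih hzy h₁ hs' ?_
      rintro (h | ⟨s, -, h, h'⟩ | h)
      · omega
      · by_cases hx : 2 * m + 1 ≤ x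
        · exact hp s (by omega) h'
        · have := h'.bounds
          omega
      · have := h.le_nine
        omega
    · by_cases h₂ : z ≤ x - (2 * m + 1)
      · refine (ih h₂ (by omega) (by omega) ?_).swap
        rintro (h | ⟨s, -, h, h'⟩ | h)
        · omega
        · have := h'.bounds
          omega
        · have := h.le_nine
          omega
      · refine (ih (x := y) (y := z) (by omega) (by omega) (by omega) ?_).rotate.rotate
        rintro (h | ⟨s, -, h, h'⟩ | h)
        · omega
        · have := h'.bounds
          omega
        · have := h.le_nine
          omega

/-! ### The growth of the burned set -/

-- Both bounds are proved together: each round burns the current frontier and one further vertex, so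
-- the bound on the frontier sums to the bound on the burned set. The `if` records that the hub
-- enlarges the frontier only once.
open Classical in
theorem BurnsTo.card_le {V : Type*} [Fintype V] {G : SimpleGraph V} {c : V}
    (hc : (Finset.univ.filter fun w => G.Adj c w).card ≤ 4)
    (hdeg : ∀ v, v ≠ c → (Finset.univ.filter fun w => G.Adj v w).card ≤ 2)
    {t : ℕ} {B : Set V} (h : BurnsTo G t B) :
    (Finset.univ.filter fun v => v ∉ B ∧ ∃ u ∈ B, G.Adj u v).card ≤
        2 * t + (if c ∈ B then 2 else 0) ∧
      (Finset.univ.filter fun v => v ∈ B).card ≤ t ^ 2 + 2 * t := by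
  induction h with
  | start => simp
  | @round t B h x hx ih =>
    obtain ⟨ih₁, ih₂⟩ := ih
    set N := Finset.univ.filter fun v => v ∉ B ∧ ∃ u ∈ B, G.Adj u v with hN
    set B' : Set V := B ∪ {v | ∃ u ∈ B, G.Adj u v} ∪ {x} with hB'
    have hmem : ∀ v, v ∈ B' ↔ v ∈ B ∨ v ∈ N ∨ v = x := by
      intro v
      simp only [hB', hN, Set.mem_union, Set.mem_ofPred_eq, Set.mem_singleton_iff,
        Finset.mem_filter, Finset.mem_univ, true_and]
      by_cases hv : v ∈ B <;> simp [hv]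
    suffices H : (Finset.univ.filter fun v => v ∉ B' ∧ ∃ u ∈ B', G.Adj u v).card ≤
          2 * (t + 1) + (if c ∈ B' then 2 else 0) ∧
        (Finset.univ.filter fun v => v ∈ B').card ≤ (t + 1) ^ 2 + 2 * (t + 1) by
      convert H
    constructor
    · set D : V → Finset V := fun v => Finset.univ.filter fun w => G.Adj v w ∧ w ∉ B' with hD
      -- New frontier vertices are reached from the old frontier or from `x`; if `x` lies in the old
      -- frontier it is already counted.
      have hsub : (Finset.univ.filter fun v => v ∉ B' ∧ ∃ u ∈ B', G.Adj u v) ⊆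
          N.biUnion D ∪ (if x ∈ N then ∅ else D x) := by
        intro w hw
        simp only [Finset.mem_filter, Finset.mem_univ, true_and] at hw
        obtain ⟨hw, u, hu, huw⟩ := hw
        have hDw : w ∈ D u := by simp [hD, huw, hw]
        rw [Finset.mem_union, Finset.mem_biUnion]
        rcases (hmem u).1 hu with hu | hu | rfl
        · refine absurd ?_ hw
          simp only [hB', Set.mem_union, Set.mem_ofPred_eq]
          exact Or.inl (Or.inr ⟨u, hu, huw⟩)
        · exact Or.inl ⟨u, hu, hDw⟩
        · by_cases hxN : u ∈ N
          · exact Or.inl ⟨u, hxN, hDw⟩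
          · exact Or.inr (by simpa [hxN] using hDw)
      -- A frontier vertex has a burned neighbour, so one of its edges leads to nothing new.
      have hDle : ∀ v ∈ N, (D v).card ≤ 1 + if v = c then 2 else 0 := by
        intro v hv
        obtain ⟨-, u, hu, huv⟩ : v ∉ B ∧ ∃ u ∈ B, G.Adj u v := by simpa [hN] using hv
        have hlt : (D v).card < (Finset.univ.filter fun w => G.Adj v w).card := by
          refine Finset.card_lt_card (Finset.ssubset_iff_of_subset ?_ |>.2 ⟨u, ?_, ?_⟩)
          · intro w hw
            simp only [hD, Finset.mem_filter, Finset.mem_univ, true_and] at hw ⊢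
            exact hw.1
          · simpa using huv.symm
          · simp only [hD, Finset.mem_filter, Finset.mem_univ, true_and, not_and, not_not]
            exact fun _ => (hmem u).2 (Or.inl hu)
        split_ifs with hvc
        · subst hvc; omega
        · have := hdeg v hvc; omega
      have hDx : (D x).card ≤ 2 + if x = c then 2 else 0 := by
        have hle : (D x).card ≤ (Finset.univ.filter fun w => G.Adj x w).card := by
          refine Finset.card_le_card fun w hw => ?_
          simp only [hD, Finset.mem_filter, Finset.mem_univ, true_and] at hw ⊢
          exact hw.1
        split_ifs with hxc
        · subst hxc; omega
        · have := hdeg x hxc; omega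
      have hsum : (N.biUnion D).card ≤ N.card + if c ∈ N then 2 else 0 := by
        refine Finset.card_biUnion_le.trans ((Finset.sum_le_sum hDle).trans ?_)
        rw [Finset.sum_add_distrib, Finset.sum_ite_eq']
        simp
      have hcard := (Finset.card_le_card hsub).trans (Finset.card_union_le _ _)
      have hcN : c ∈ N → c ∉ B := fun h => (Finset.mem_filter.1 h).2.1
      have hB : c ∈ B → c ∈ B' := fun h => (hmem c).2 (Or.inl h)
      have hNB : c ∈ N → c ∈ B' := fun h => (hmem c).2 (Or.inr (Or.inl h))
      have hxB : x = c → c ∈ B' := fun h => (hmem c).2 (Or.inr (Or.inr h.symm))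
      have hxc : x = c → c ∉ B := fun h => h ▸ hx
      have hxN : x = c → c ∈ N → x ∈ N := fun h h' => h ▸ h'
      generalize (Finset.univ.filter fun v => v ∉ B' ∧ ∃ u ∈ B', G.Adj u v).card = k at *
      clear hsub hDle hmem hdeg hc ih₂ h hN hB' hD
      -- The extra 2 of the hub is charged either to `N` or to `x`, never to both.
      have hDx' : (if x ∈ N then (∅ : Finset V) else D x).card ≤
          2 + if x = c ∧ x ∉ N then 2 else 0 := by
        by_cases h₁ : x ∈ N
        · simp [h₁]
        · simpa [h₁] using hDx
      generalize (if x ∈ N then (∅ : Finset V) else D x).card = d at *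
      generalize (N.biUnion D).card = e at *
      generalize N.card = l at *
      by_cases h₁ : c ∈ N
      · rw [if_pos h₁] at hsum
        rw [if_neg (hcN h₁)] at ih₁
        rw [if_neg fun h => h.2 (hxN h.1 h₁)] at hDx'
        rw [if_pos (hNB h₁)]
        omega
      · rw [if_neg h₁] at hsum
        by_cases h₂ : c ∈ B
        · rw [if_pos h₂] at ih₁
          rw [if_neg fun h => hxc h.1 h₂] at hDx'
          rw [if_pos (hB h₂)]
          omega
        · rw [if_neg h₂] at ih₁
          by_cases h₃ : x = c
          · rw [if_pos (hxB h₃)]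
            split_ifs at hDx' <;> omega
          · rw [if_neg fun h => h₃ h.1] at hDx'
            omega
    · have hsub : (Finset.univ.filter fun v => v ∈ B') ⊆
          (Finset.univ.filter fun v => v ∈ B) ∪ N ∪ {x} := by
        intro v hv
        have := (hmem v).1 (by simpa using hv)
        simp only [Finset.mem_union, Finset.mem_filter, Finset.mem_univ, true_and,
          Finset.mem_singleton]
        tauto
      have h₁ := Finset.card_le_card hsub
      have h₂ := Finset.card_union_le ((Finset.univ.filter fun v => v ∈ B) ∪ N) {x}
      have h₃ := Finset.card_union_le (Finset.univ.filter fun v => v ∈ B) N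
      have h₄ : (if c ∈ B then 2 else 0) ≤ 2 := by split_ifs <;> norm_num
      rw [Finset.card_singleton] at h₂
      nlinarith

/-! ### Burning by covering with balls -/

/-- `Near G r u v`: the vertex `v` is at distance at most `r` from `u`. -/
def Near {V : Type*} (G : SimpleGraph V) : ℕ → V → V → Prop
  | 0, u, v => u = v
  | r + 1, u, v => Near G r u v ∨ ∃ w, Near G r u w ∧ G.Adj w v

theorem Near.trans {V : Type*} {G : SimpleGraph V} {r s : ℕ} {u v w : V} (h : Near G r u v)
    (h' : Near G s v w) : Near G (r + s) u w := by
  induction s generalizing w with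
  | zero => exact (show v = w from h') ▸ h
  | succ s ih =>
    rcases h' with h' | ⟨x, h', hx⟩
    · exact Or.inl (ih h')
    · exact Or.inr ⟨x, ih h', hx⟩

theorem near_of_chain {V : Type*} {G : SimpleGraph V} {f : ℕ → V} {x : ℕ}
    (hf : ∀ j, j + 1 < x → G.Adj (f j) (f (j + 1))) {r c j : ℕ} (hc : c < x) (hj : j < x)
    (h₁ : j ≤ c + r) (h₂ : c ≤ j + r) : Near G r (f c) (f j) := by
  induction r generalizing j with
  | zero => exact congrArg f (by omega)
  | succ r ih =>
    by_cases h₃ : j = c + (r + 1)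
    · subst h₃
      exact Or.inr ⟨f (c + r), ih (by omega) (by omega) (by omega), hf (c + r) hj⟩
    · by_cases h₄ : c = j + (r + 1)
      · exact Or.inr ⟨f (j + 1), ih (by omega) (by omega) (by omega), (hf j (by omega)).symm⟩
      · exact Or.inl (ih hj (by omega) (by omega))

theorem isBurnable_of_near {V : Type*} {G : SimpleGraph V} {k : ℕ} (c : ℕ → V)
    (hc : ∀ v, ∃ i < k, Near G i (c i) v) : IsBurnable G k := by
  -- A fire lit at `c i` in round k - i has reached distance r = i - (k - t) by the end of round t.
  have key : ∀ t ≤ k, IsBurnable G t ∨ ∃ B, BurnsTo G t B ∧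
      ∀ i < k, ∀ r, r + (k - t) = i → ∀ v, Near G r (c i) v → v ∈ B := by
    intro t ht
    induction t with
    | zero => exact Or.inr ⟨∅, .start, fun i hi r hr => by omega⟩
    | succ t ih =>
      rcases ih (by omega) with ⟨t', ht', h⟩ | ⟨B, hB, h⟩
      · exact Or.inl ⟨t', by omega, h⟩
      by_cases hu : B = Set.univ
      · exact Or.inl ⟨t, by omega, hu ▸ hB⟩
      -- If the prescribed centre is already burned, any unburned vertex is a legal choice and
      -- nothing is lost.
      obtain ⟨x, hx, hcx⟩ : ∃ x, x ∉ B ∧ (c (k - (t + 1)) = x ∨ c (k - (t + 1)) ∈ B) := by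
        by_cases hcB : c (k - (t + 1)) ∈ B
        · obtain ⟨x, hx⟩ := (Set.ne_univ_iff_exists_notMem B).1 hu
          exact ⟨x, hx, Or.inr hcB⟩
        · exact ⟨_, hcB, Or.inl rfl⟩
      refine Or.inr ⟨_, hB.round x hx, ?_⟩
      rintro i hi (_ | r) hr v hv
      · obtain rfl : i = k - (t + 1) := by omega
        obtain rfl : c (k - (t + 1)) = v := hv
        rcases hcx with h | h
        · exact Or.inr h
        · exact Or.inl (Or.inl h)
      · rcases hv with hv | ⟨w, hw, hwv⟩
        · exact Or.inl (Or.inl (h i hi r (by omega) v hv))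
        · exact Or.inl (Or.inr ⟨w, h i hi r (by omega) w hw, hwv⟩)
  rcases key k le_rfl with h | ⟨B, hB, h⟩
  · exact h
  · refine ⟨k, le_rfl, ?_⟩
    rwa [show B = Set.univ from Set.eq_univ_of_forall fun v => ?_] at hB
    obtain ⟨i, hi, hv⟩ := hc v
    exact h i hi i (by omega) v hv

theorem exists_near_of_chain {V : Type*} {G : SimpleGraph V} {f : ℕ → V} {x : ℕ}
    (hf : ∀ j, j + 1 < x → G.Adj (f j) (f (j + 1))) (m : ℕ) :
    ∃ c, ∀ j < x, x - (2 * m + 1) ≤ j → Near G m c (f j) :=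
  -- The centre is the middle of the last 2m + 1 vertices; for x ≤ m + 1 the subtraction truncates
  -- to `f 0`, whose ball still reaches the whole chain.
  ⟨f (x - 1 - m), fun _ _ _ => near_of_chain hf (by omega) (by omega) (by omega) (by omega)⟩

theorem Coverable.exists_centers {V : Type*} {G : SimpleGraph V} {f₁ f₂ f₃ : ℕ → V} {m x y z : ℕ}
    (h : Coverable m x y z)
    (h₁ : ∀ j, j + 1 < x → G.Adj (f₁ j) (f₁ (j + 1)))
    (h₂ : ∀ j, j + 1 < y → G.Adj (f₂ j) (f₂ (j + 1)))
    (h₃ : ∀ j, j + 1 < z → G.Adj (f₃ j) (f₃ (j + 1))) :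
    ∃ c : ℕ → V, (∀ j < x, ∃ i < m, Near G i (c i) (f₁ j)) ∧
      (∀ j < y, ∃ i < m, Near G i (c i) (f₂ j)) ∧ ∀ j < z, ∃ i < m, Near G i (c i) (f₃ j) := by
  induction m generalizing x y z with
  | zero =>
    obtain ⟨rfl, rfl, rfl⟩ := h
    exact ⟨f₁, by simp, by simp, by simp⟩
  | succ m ih =>
    have lift : ∀ {c : ℕ → V} {c₀ v : V}, (∃ i < m, Near G i (c i) v) ∨ Near G m c₀ v →
        ∃ i < m + 1, Near G i (Function.update c m c₀ i) v := by
      rintro c c₀ v (⟨i, hi, h⟩ | h)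
      · exact ⟨i, by omega, by rwa [Function.update_of_ne (by omega)]⟩
      · exact ⟨m, by omega, by rwa [Function.update_self]⟩
    rcases h with h | h | h
    · obtain ⟨c, k₁, k₂, k₃⟩ := ih h (fun j hj => h₁ j (by omega)) h₂ h₃
      obtain ⟨c₀, hc₀⟩ := exists_near_of_chain h₁ m
      refine ⟨Function.update c m c₀, fun j hj => lift ?_, fun j hj => lift (Or.inl (k₂ j hj)),
        fun j hj => lift (Or.inl (k₃ j hj))⟩
      exact (lt_or_ge j (x - (2 * m + 1))).imp (k₁ j) (hc₀ j hj)
    · obtain ⟨c, k₁, k₂, k₃⟩ := ih h h₁ (fun j hj => h₂ j (by omega)) h₃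
      obtain ⟨c₀, hc₀⟩ := exists_near_of_chain h₂ m
      refine ⟨Function.update c m c₀, fun j hj => lift (Or.inl (k₁ j hj)), fun j hj => lift ?_,
        fun j hj => lift (Or.inl (k₃ j hj))⟩
      exact (lt_or_ge j (y - (2 * m + 1))).imp (k₂ j) (hc₀ j hj)
    · obtain ⟨c, k₁, k₂, k₃⟩ := ih h h₁ h₂ (fun j hj => h₃ j (by omega))
      obtain ⟨c₀, hc₀⟩ := exists_near_of_chain h₃ m
      refine ⟨Function.update c m c₀, fun j hj => lift (Or.inl (k₁ j hj)),
        fun j hj => lift (Or.inl (k₂ j hj)), fun j hj => lift ?_⟩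
      exact (lt_or_ge j (z - (2 * m + 1))).imp (k₃ j) (hc₀ j hj)

/-! ### The graph: two arms and a cycle meeting at the hub -/

namespace unicyclicGraph

/-- The vertex of the cycle with index `i` modulo `g`; index `0` is the hub. -/
def cyc {g : ℕ} (hg : 3 ≤ g) (a₁ a₂ i : ℕ) : Fin g ⊕ Fin a₁ ⊕ Fin a₂ :=
  .inl ⟨i % g, Nat.mod_lt _ (by omega)⟩

/-- The vertex at distance `j` from the hub on the first pendant path. -/
def arm₁ {g : ℕ} (hg : 3 ≤ g) (a₁ a₂ j : ℕ) : Fin g ⊕ Fin a₁ ⊕ Fin a₂ :=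
  if h : 1 ≤ j ∧ j ≤ a₁ then .inr (.inl ⟨j - 1, by omega⟩) else cyc hg a₁ a₂ 0

/-- The vertex at distance `j` from the hub on the second pendant path. -/
def arm₂ {g : ℕ} (hg : 3 ≤ g) (a₁ a₂ j : ℕ) : Fin g ⊕ Fin a₁ ⊕ Fin a₂ :=
  if h : 1 ≤ j ∧ j ≤ a₂ then .inr (.inr ⟨j - 1, by omega⟩) else cyc hg a₁ a₂ 0

variable {g a₁ a₂ : ℕ}

theorem cycleGraph_adj_iff (hg : 3 ≤ g) {u v : Fin g} : (SimpleGraph.cycleGraph g).Adj u v ↔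
    (u.val + 1 = v.val ∨ v.val + 1 = u.val ∨ (u.val = 0 ∧ v.val + 1 = g) ∨
      (v.val = 0 ∧ u.val + 1 = g)) := by
  have key : ∀ x y : Fin g, (x - y).val = 1 ↔
      (y.val + 1 = x.val ∨ (x.val = 0 ∧ y.val + 1 = g)) := by
    intro x y
    rcases le_or_gt y x with h | h
    · rw [Fin.sub_val_of_le h]
      have := Fin.le_def.1 h
      omega
    · rw [Fin.coe_sub_iff_lt.2 h]
      have := Fin.lt_def.1 h
      omega
  rw [SimpleGraph.cycleGraph_adj', key, key]
  omega

theorem adj_cyc (hg : 3 ≤ g) (i : ℕ) (hi : i < g) :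
    (unicyclicGraph g a₁ a₂).Adj (cyc hg a₁ a₂ i) (cyc hg a₁ a₂ (i + 1)) := by
  have h₀ : i % g = i := Nat.mod_eq_of_lt hi
  have h₁ : (i + 1) % g = i + 1 ∨ (i + 1 = g ∧ (i + 1) % g = 0) := by
    rcases Nat.lt_or_ge (i + 1) g with h | h
    · exact Or.inl (Nat.mod_eq_of_lt h)
    · have : i + 1 = g := by omega
      exact Or.inr ⟨this, by rw [this, Nat.mod_self]⟩
  simp only [unicyclicGraph, SimpleGraph.fromRel_adj, cyc, cycleGraph_adj_iff hg, ne_eq,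
    Sum.inl.injEq, Fin.mk.injEq]
  omega

theorem adj_arm₁ (hg : 3 ≤ g) (j : ℕ) (hj : j < a₁) :
    (unicyclicGraph g a₁ a₂).Adj (arm₁ hg a₁ a₂ j) (arm₁ hg a₁ a₂ (j + 1)) := by
  rcases j with _ | j
  · simp [unicyclicGraph, arm₁, cyc, Nat.succ_le_of_lt hj]
  · have h : j + 1 ≤ a₁ := by omega
    have h' : j + 1 + 1 ≤ a₁ := by omega
    simp [unicyclicGraph, arm₁, h, h', SimpleGraph.pathGraph_adj]

theorem adj_arm₂ (hg : 3 ≤ g) (j : ℕ) (hj : j < a₂) :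
    (unicyclicGraph g a₁ a₂).Adj (arm₂ hg a₁ a₂ j) (arm₂ hg a₁ a₂ (j + 1)) := by
  rcases j with _ | j
  · simp [unicyclicGraph, arm₂, cyc, Nat.succ_le_of_lt hj]
  · have h : j + 1 ≤ a₂ := by omega
    have h' : j + 1 + 1 ≤ a₂ := by omega
    simp [unicyclicGraph, arm₂, h, h', SimpleGraph.pathGraph_adj]

theorem forall_vertex (hg : 3 ≤ g) {P : Fin g ⊕ Fin a₁ ⊕ Fin a₂ → Prop}
    (hc : ∀ i < g, P (cyc hg a₁ a₂ i))
    (h₁ : ∀ j < a₁, P (arm₁ hg a₁ a₂ (j + 1))) (h₂ : ∀ j < a₂, P (arm₂ hg a₁ a₂ (j + 1))) :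
    ∀ v, P v := by
  rintro (i | j | j)
  · simpa [cyc, Nat.mod_eq_of_lt i.2] using hc i i.2
  · simpa [arm₁, Nat.succ_le_of_lt j.2] using h₁ j j.2
  · simpa [arm₂, Nat.succ_le_of_lt j.2] using h₂ j j.2

open Classical in
theorem card_adj_hub_le (hg : 3 ≤ g) :
    (Finset.univ.filter fun w => (unicyclicGraph g a₁ a₂).Adj (cyc hg a₁ a₂ 0) w).card ≤ 4 := by
  have hsub : (Finset.univ.filter fun w => (unicyclicGraph g a₁ a₂).Adj (cyc hg a₁ a₂ 0) w) ⊆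
      {cyc hg a₁ a₂ 1, cyc hg a₁ a₂ (g - 1), arm₁ hg a₁ a₂ 1, arm₂ hg a₁ a₂ 1} := by
    intro w hw
    rw [Finset.mem_filter] at hw
    replace hw := hw.2
    have m₁ : 1 % g = 1 := Nat.mod_eq_of_lt (by omega)
    have m₂ : (g - 1) % g = g - 1 := Nat.mod_eq_of_lt (by omega)
    rcases w with ⟨i, hi⟩ | ⟨j, hj⟩ | ⟨j, hj⟩
    · have hz : 0 % g = 0 := Nat.zero_mod g
      simp only [unicyclicGraph, SimpleGraph.fromRel_adj, cyc, cycleGraph_adj_iff hg, ne_eq,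
        Sum.inl.injEq, Fin.mk.injEq] at hw
      simp only [Finset.mem_insert, cyc, Sum.inl.injEq, Fin.mk.injEq]
      omega
    · have hj0 : j = 0 := by simpa [unicyclicGraph, cyc] using hw
      subst hj0
      simp [arm₁, Nat.succ_le_of_lt hj]
    · have hj0 : j = 0 := by simpa [unicyclicGraph, cyc] using hw
      subst hj0
      simp [arm₂, Nat.succ_le_of_lt hj]
  exact (Finset.card_le_card hsub).trans Finset.card_le_four

open Classical in
theorem card_adj_le (hg : 3 ≤ g) (v : Fin g ⊕ Fin a₁ ⊕ Fin a₂) (hv : v ≠ cyc hg a₁ a₂ 0) :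
    (Finset.univ.filter fun w => (unicyclicGraph g a₁ a₂).Adj v w).card ≤ 2 := by
  obtain ⟨x, y, h⟩ : ∃ x y, ∀ w, (unicyclicGraph g a₁ a₂).Adj v w → w = x ∨ w = y := by
    rcases v with ⟨i, hi⟩ | ⟨j, hj⟩ | ⟨j, hj⟩
    · refine ⟨cyc hg a₁ a₂ (i + 1), cyc hg a₁ a₂ (i - 1), ?_⟩
      have hi0 : i ≠ 0 := by
        rintro rfl
        simp [cyc] at hv
      have h₁ : (i + 1 < g ∧ (i + 1) % g = i + 1) ∨ (i + 1 = g ∧ (i + 1) % g = 0) := by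
        rcases Nat.lt_or_ge (i + 1) g with h | h
        · exact Or.inl ⟨h, Nat.mod_eq_of_lt h⟩
        · have : i + 1 = g := by omega
          exact Or.inr ⟨this, by rw [this, Nat.mod_self]⟩
      have h₂ : (i - 1) % g = i - 1 := Nat.mod_eq_of_lt (by omega)
      rintro (⟨k, hk⟩ | ⟨k, hk⟩ | ⟨k, hk⟩) hw
      · simp only [unicyclicGraph, SimpleGraph.fromRel_adj, cycleGraph_adj_iff hg, ne_eq,
          Sum.inl.injEq, Fin.mk.injEq] at hw
        simp only [cyc, Sum.inl.injEq, Fin.mk.injEq]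
        omega
      · simp [unicyclicGraph, hi0] at hw
      · simp [unicyclicGraph, hi0] at hw
    · refine ⟨arm₁ hg a₁ a₂ j, arm₁ hg a₁ a₂ (j + 2), ?_⟩
      rintro (⟨k, hk⟩ | ⟨k, hk⟩ | ⟨k, hk⟩) hw
      · have : k = 0 ∧ j = 0 := by simpa [unicyclicGraph] using hw
        obtain ⟨rfl, rfl⟩ := this
        simp [arm₁, cyc]
      · have hw : j + 1 = k ∨ k + 1 = j := by
          simp only [unicyclicGraph, SimpleGraph.fromRel_adj, SimpleGraph.pathGraph_adj] at hw
          omega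
        rcases hw with rfl | rfl
        · right; simp [arm₁, Nat.succ_le_of_lt hk]
        · left; simp [arm₁, Nat.succ_le_of_lt hk]
      · simp [unicyclicGraph] at hw
    · refine ⟨arm₂ hg a₁ a₂ j, arm₂ hg a₁ a₂ (j + 2), ?_⟩
      rintro (⟨k, hk⟩ | ⟨k, hk⟩ | ⟨k, hk⟩) hw
      · have : k = 0 ∧ j = 0 := by simpa [unicyclicGraph] using hw
        obtain ⟨rfl, rfl⟩ := this
        simp [arm₂, cyc]
      · simp [unicyclicGraph] at hw
      · have hw : j + 1 = k ∨ k + 1 = j := by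
          simp only [unicyclicGraph, SimpleGraph.fromRel_adj, SimpleGraph.pathGraph_adj] at hw
          omega
        rcases hw with rfl | rfl
        · right; simp [arm₂, Nat.succ_le_of_lt hk]
        · left; simp [arm₂, Nat.succ_le_of_lt hk]
  refine (Finset.card_le_card (t := {x, y}) fun w hw => ?_).trans Finset.card_le_two
  simpa using h w (Finset.mem_filter.1 hw).2

theorem le_of_isBurnable (hg : 3 ≤ g) {q k : ℕ} (hn : q ^ 2 ≤ g + a₁ + a₂)
    (h : IsBurnable (unicyclicGraph g a₁ a₂) k) : q ≤ k := by
  classical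
  obtain ⟨t, htk, h⟩ := h
  have := (h.card_le (card_adj_hub_le hg) (card_adj_le hg)).2
  simp only [Set.mem_univ, Finset.filter_true, Finset.card_univ, Fintype.card_sum,
    Fintype.card_fin] at this
  by_contra hlt
  have : (t + 1) ^ 2 ≤ q ^ 2 := Nat.pow_le_pow_left (by omega) 2
  nlinarith

/-- Placing the largest ball at distance `d` from the hub on the first pendant path leaves three
paths to be covered. -/
theorem isBurnable_of_coverable (hg : 3 ≤ g) {m d : ℕ} (hdm : d ≤ m) (hda : d ≤ a₁)
    (h : Coverable m (g - (2 * (m - d) + 1)) (a₁ - (m + d)) (a₂ - (m - d))) :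
    IsBurnable (unicyclicGraph g a₁ a₂) (m + 1) := by
  -- The large ball spends `d` steps reaching the hub, leaving m - d on the second arm and in each
  -- direction of the cycle. The three chains start just beyond it.
  obtain ⟨c, k₁, k₂, k₃⟩ := h.exists_centers (G := unicyclicGraph g a₁ a₂)
    (f₁ := fun j => cyc hg a₁ a₂ (m - d + 1 + j)) (f₂ := fun j => arm₁ hg a₁ a₂ (m + d + 1 + j))
    (f₃ := fun j => arm₂ hg a₁ a₂ (m - d + 1 + j))
    (fun j hj => adj_cyc hg _ (by omega)) (fun j hj => adj_arm₁ hg _ (by omega))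
    (fun j hj => adj_arm₂ hg _ (by omega))
  have lift : ∀ {v}, ((∃ i < m, Near (unicyclicGraph g a₁ a₂) i (c i) v) ∨
      Near (unicyclicGraph g a₁ a₂) m (arm₁ hg a₁ a₂ d) v) →
        ∃ i < m + 1, Near (unicyclicGraph g a₁ a₂) i
          (Function.update c m (arm₁ hg a₁ a₂ d) i) v := by
    rintro v (⟨i, hi, h⟩ | h)
    · exact ⟨i, by omega, by rwa [Function.update_of_ne (by omega)]⟩
    · exact ⟨m, by omega, by rwa [Function.update_self]⟩
  have near₁ : ∀ {r j}, j ≤ a₁ → j ≤ d + r → d ≤ j + r →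
      Near (unicyclicGraph g a₁ a₂) r (arm₁ hg a₁ a₂ d) (arm₁ hg a₁ a₂ j) := fun hj h₁ h₂ =>
    near_of_chain (x := a₁ + 1) (fun j hj => adj_arm₁ hg j (by omega)) (by omega) (by omega) h₁ h₂
  have hub₁ : arm₁ hg a₁ a₂ 0 = cyc hg a₁ a₂ 0 := by simp [arm₁]
  have hub₂ : arm₂ hg a₁ a₂ 0 = cyc hg a₁ a₂ 0 := by simp [arm₂]
  -- Since index `g` is the hub again, going down from `g` gives the other side of the ball on the
  -- cycle.
  have hubg : cyc hg a₁ a₂ g = cyc hg a₁ a₂ 0 := by simp [cyc]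
  have hhub : Near (unicyclicGraph g a₁ a₂) d (arm₁ hg a₁ a₂ d) (cyc hg a₁ a₂ 0) :=
    hub₁ ▸ near₁ (by omega) (by omega) (by omega)
  have hchain : ∀ j, j + 1 < g + 1 →
      (unicyclicGraph g a₁ a₂).Adj (cyc hg a₁ a₂ j) (cyc hg a₁ a₂ (j + 1)) :=
    fun j hj => adj_cyc hg j (by omega)
  have hm : d + (m - d) = m := by omega
  refine isBurnable_of_near (Function.update c m (arm₁ hg a₁ a₂ d))
    (forall_vertex hg (fun i hi => lift ?_) (fun j hj => lift ?_) (fun j hj => lift ?_))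
  · by_cases h₁ : i ≤ m - d
    · right
      rw [← hm]
      exact hhub.trans (near_of_chain hchain (by omega) (by omega) (by omega) (by omega))
    · by_cases h₂ : g ≤ i + (m - d)
      · right
        rw [← hm]
        refine hhub.trans ?_
        rw [← hubg]
        exact near_of_chain hchain (by omega) (by omega) (by omega) (by omega)
      · left
        obtain ⟨j, rfl⟩ : ∃ j, i = m - d + 1 + j := ⟨i - (m - d + 1), by omega⟩
        exact k₁ j (by omega)
  · by_cases h₁ : j + 1 ≤ m + d
    · exact Or.inr (near₁ (by omega) (by omega) (by omega))
    · left
      obtain ⟨i, hi⟩ : ∃ i, j + 1 = m + d + 1 + i := ⟨j - (m + d), by omega⟩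
      rw [hi]
      exact k₂ i (by omega)
  · by_cases h₁ : j + 1 ≤ m - d
    · right
      rw [← hm]
      refine hhub.trans ?_
      rw [← hub₂]
      exact near_of_chain (x := a₂ + 1) (fun j hj => adj_arm₂ hg j (by omega)) (by omega)
        (by omega) (by omega) (by omega)
    · left
      obtain ⟨i, hi⟩ : ∃ i, j + 1 = m - d + 1 + i := ⟨j - (m - d), by omega⟩
      rw [hi]
      exact k₃ i (by omega)

end unicyclicGraph

/-! ### Comparison with the exceptional families -/

/-- For d = 0, the family z = 2 goes to the infinite part of `exceptC4`, deficit 0 mostly to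
`exceptB1`, and larger deficits to `exceptC3` and `exceptC2`. A second arm inside the ball truncates
to length 0, which gives `exceptC1`. The last alternative collects the listed triples outside every
family; they need d = 1. -/
theorem mem_exceptC_of_cycle_longest {g a₁ a₂ m r : ℕ} (hg : 2 * (m + 1) ≤ g)
    (hn : g + a₁ + a₂ = (m + 1) ^ 2 + r)
    (h₁ : a₁ - m ≤ g - (2 * m + 1)) (h₂ : a₂ - m ≤ a₁ - m)
    (hE : Exceptional m (g - (2 * m + 1)) (a₁ - m) (a₂ - m)) :
    ((g : ℤ), (a₁ : ℤ), (a₂ : ℤ)) ∈ exceptC ((m + 1 : ℕ) : ℤ) r ∨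
      a₁ = m + 2 ∧ a₂ = m + 2 ∧
        (g - (2 * m + 1) + 6 = m ^ 2 ∨ g - (2 * m + 1) + 7 = m ^ 2) := by
  have hsq : (m + 1) ^ 2 = m ^ 2 + 2 * m + 1 := by ring
  -- Casting the natural number `m ^ 2` leaves one square to generalize, after which the arithmetic
  -- is linear.
  have hsq' : ((m : ℤ) + 1) ^ 2 = ((m ^ 2 : ℕ) : ℤ) + 2 * m + 1 := by push_cast; ring
  rcases hE with ⟨hs, hz⟩ | ⟨s, -, hs, hp⟩ | hp
  · left
    have h : ((g : ℤ), (a₁ : ℤ), (a₂ : ℤ)) ∈ exceptC4 ((m + 1 : ℕ) : ℤ) := by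
      refine Or.inl (Or.inl ?_)
      simp only [Set.mem_ofPred_eq, Nat.cast_add, Nat.cast_one, hsq']
      generalize m ^ 2 = M at *
      omega
    simp only [exceptC, Set.mem_union]
    tauto
  · suffices h : ((g : ℤ), (a₁ : ℤ), (a₂ : ℤ)) ∈ exceptB1 ((m + 1 : ℕ) : ℤ) ∪
        (exceptC3 ((m + 1 : ℕ) : ℤ) ∪ (exceptC2 ((m + 1 : ℕ) : ℤ) ∪
          exceptC1 ((m + 1 : ℕ) : ℤ) r)) ∨
        a₁ = m + 2 ∧ a₂ = m + 2 ∧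
        (g - (2 * m + 1) + 6 = m ^ 2 ∨ g - (2 * m + 1) + 7 = m ^ 2) by
      refine h.imp_left fun h => ?_
      simp only [exceptC, exceptC4, Set.mem_union] at h ⊢
      tauto
    simp only [PairExceptional, List.mem_cons, Prod.mk.injEq, List.not_mem_nil, or_false] at hp
    simp only [exceptB1, exceptC1, exceptC2, exceptC3, Set.mem_union, Set.mem_insert_iff,
      Set.mem_singleton_iff, Prod.mk.injEq, Nat.cast_add, Nat.cast_one, hsq', or_assoc]
    generalize m ^ 2 = M at *
    rcases hp with hp | hp | hp | hp | hp | hp | hp | hp | hp | hp | hp | hp | hp | hp | hp | hp |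
      hp | hp | hp | hp | hp | hp | hp | hp | hp
    all_goals
      -- This walks along the disjunction until the matching family member is found.
      repeat first | exact Or.inl (by omega) | refine Or.inr ?_
      try omega
  · left
    suffices h : ((g : ℤ), (a₁ : ℤ), (a₂ : ℤ)) ∈ exceptB4 ∪ exceptC3 ((m + 1 : ℕ) : ℤ) by
      simp only [exceptC, exceptC4, Set.mem_union] at h ⊢
      tauto
    simp only [SporadicExceptional, List.mem_cons, Prod.mk.injEq, List.not_mem_nil, or_false] at hp
    simp only [exceptB4, exceptC3, Set.mem_union, Set.mem_insert_iff,
      Set.mem_singleton_iff, Prod.mk.injEq, Nat.cast_add, Nat.cast_one, or_assoc]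
    clear hsq' hn hsq
    rcases hp with hp | hp | hp | hp | hp | hp | hp | hp | hp | hp | hp | hp | hp | hp | hp | hp |
      hp | hp | hp | hp | hp | hp | hp | hp
    all_goals
      repeat first | exact Or.inl (by omega) | refine Or.inr ?_
      try omega

theorem mem_exceptC_of_cycle_middle {g a₁ a₂ m r : ℕ} (hg : 2 * (m + 1) ≤ g)
    (hn : g + a₁ + a₂ = (m + 1) ^ 2 + r)
    (h₁ : g - (2 * m + 1) ≤ a₁ - m) (h₂ : a₂ - m ≤ g - (2 * m + 1))
    (hE : Exceptional m (a₁ - m) (g - (2 * m + 1)) (a₂ - m)) :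
    ((g : ℤ), (a₁ : ℤ), (a₂ : ℤ)) ∈ exceptC ((m + 1 : ℕ) : ℤ) r ∨
      (g = 2 * m + 3 ∨ g = 2 * m + 4) ∧ a₂ = m + 2 ∧ a₁ - m + 7 = m ^ 2 := by
  have hsq : (m + 1) ^ 2 = m ^ 2 + 2 * m + 1 := by ring
  have hsq' : ((m : ℤ) + 1) ^ 2 = ((m ^ 2 : ℕ) : ℤ) + 2 * m + 1 := by push_cast; ring
  rcases hE with ⟨hs, hz⟩ | ⟨s, -, hs, hp⟩ | hp
  · left
    have h : ((g : ℤ), (a₁ : ℤ), (a₂ : ℤ)) ∈ exceptC5 ((m + 1 : ℕ) : ℤ) := by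
      refine Or.inl (Or.inl ?_)
      simp only [Set.mem_ofPred_eq, Nat.cast_add, Nat.cast_one, hsq']
      generalize m ^ 2 = M at *
      omega
    simp only [exceptC, Set.mem_union]
    tauto
  · suffices h : ((g : ℤ), (a₁ : ℤ), (a₂ : ℤ)) ∈ exceptB2 ((m + 1 : ℕ) : ℤ) ∪
        (exceptC3 ((m + 1 : ℕ) : ℤ) ∪ (exceptC2 ((m + 1 : ℕ) : ℤ) ∪
          exceptC1 ((m + 1 : ℕ) : ℤ) r)) ∨
        (g = 2 * m + 3 ∨ g = 2 * m + 4) ∧ a₂ = m + 2 ∧ a₁ - m + 7 = m ^ 2 by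
      refine h.imp_left fun h => ?_
      simp only [exceptC, exceptC5, Set.mem_union] at h ⊢
      tauto
    simp only [PairExceptional, List.mem_cons, Prod.mk.injEq, List.not_mem_nil, or_false] at hp
    simp only [exceptB2, exceptC1, exceptC2, exceptC3, Set.mem_union, Set.mem_insert_iff,
      Set.mem_singleton_iff, Prod.mk.injEq, Nat.cast_add, Nat.cast_one, hsq', or_assoc]
    generalize m ^ 2 = M at *
    rcases hp with hp | hp | hp | hp | hp | hp | hp | hp | hp | hp | hp | hp | hp | hp | hp | hp |
      hp | hp | hp | hp | hp | hp | hp | hp | hp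
    all_goals
      repeat first | exact Or.inl (by omega) | refine Or.inr ?_
      try omega
  · left
    suffices h : ((g : ℤ), (a₁ : ℤ), (a₂ : ℤ)) ∈ exceptB5 ∪ exceptC3 ((m + 1 : ℕ) : ℤ) by
      simp only [exceptC, exceptC5, Set.mem_union] at h ⊢
      tauto
    simp only [SporadicExceptional, List.mem_cons, Prod.mk.injEq, List.not_mem_nil, or_false] at hp
    simp only [exceptB5, exceptC3, Set.mem_union, Set.mem_insert_iff,
      Set.mem_singleton_iff, Prod.mk.injEq, Nat.cast_add, Nat.cast_one, or_assoc]
    clear hsq' hn hsq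
    rcases hp with hp | hp | hp | hp | hp | hp | hp | hp | hp | hp | hp | hp | hp | hp | hp | hp |
      hp | hp | hp | hp | hp | hp | hp | hp
    all_goals
      repeat first | exact Or.inl (by omega) | refine Or.inr ?_
      try omega

/-- The strict inequality `h₂` sends ties to the other two cases, so nothing is left over here. -/
theorem mem_exceptC_of_cycle_shortest {g a₁ a₂ m r : ℕ} (hg : 2 * (m + 1) ≤ g)
    (hn : g + a₁ + a₂ = (m + 1) ^ 2 + r)
    (h₁ : a₂ - m ≤ a₁ - m) (h₂ : g - (2 * m + 1) < a₂ - m)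
    (hE : Exceptional m (a₁ - m) (a₂ - m) (g - (2 * m + 1))) :
    ((g : ℤ), (a₁ : ℤ), (a₂ : ℤ)) ∈ exceptC ((m + 1 : ℕ) : ℤ) r := by
  have hsq : (m + 1) ^ 2 = m ^ 2 + 2 * m + 1 := by ring
  have hsq' : ((m : ℤ) + 1) ^ 2 = ((m ^ 2 : ℕ) : ℤ) + 2 * m + 1 := by push_cast; ring
  rcases hE with ⟨hs, hz⟩ | ⟨s, -, hs, hp⟩ | hp
  · have h : ((g : ℤ), (a₁ : ℤ), (a₂ : ℤ)) ∈ exceptC6 ((m + 1 : ℕ) : ℤ) := by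
      refine Or.inl (Or.inl ?_)
      simp only [Set.mem_ofPred_eq, Nat.cast_add, Nat.cast_one, hsq']
      generalize m ^ 2 = M at *
      omega
    simp only [exceptC, Set.mem_union]
    tauto
  · suffices h : ((g : ℤ), (a₁ : ℤ), (a₂ : ℤ)) ∈ exceptB3 ((m + 1 : ℕ) : ℤ) ∪
        (exceptC3 ((m + 1 : ℕ) : ℤ) ∪ (exceptC2 ((m + 1 : ℕ) : ℤ) ∪
          exceptC1 ((m + 1 : ℕ) : ℤ) r)) by
      simp only [exceptC, exceptC6, Set.mem_union] at h ⊢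
      tauto
    simp only [PairExceptional, List.mem_cons, Prod.mk.injEq, List.not_mem_nil, or_false] at hp
    simp only [exceptB3, exceptC1, exceptC2, exceptC3, Set.mem_union, Set.mem_insert_iff,
      Set.mem_singleton_iff, Prod.mk.injEq, Nat.cast_add, Nat.cast_one, hsq', or_assoc]
    generalize m ^ 2 = M at *
    rcases hp with hp | hp | hp | hp | hp | hp | hp | hp | hp | hp | hp | hp | hp | hp | hp | hp |
      hp | hp | hp | hp | hp | hp | hp | hp | hp
    all_goals
      repeat first | exact Or.inl (by omega) | refine Or.inr ?_
      try omega
  · suffices h : ((g : ℤ), (a₁ : ℤ), (a₂ : ℤ)) ∈ exceptB6 ∪ exceptC3 ((m + 1 : ℕ) : ℤ) by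
      simp only [exceptC, exceptC6, Set.mem_union] at h ⊢
      tauto
    simp only [SporadicExceptional, List.mem_cons, Prod.mk.injEq, List.not_mem_nil, or_false] at hp
    simp only [exceptB6, exceptC3, Set.mem_union, Set.mem_insert_iff,
      Set.mem_singleton_iff, Prod.mk.injEq, Nat.cast_add, Nat.cast_one, or_assoc]
    clear hsq' hn hsq
    rcases hp with hp | hp | hp | hp | hp | hp | hp | hp | hp | hp | hp | hp | hp | hp | hp | hp |
      hp | hp | hp | hp | hp | hp | hp | hp
    all_goals
      repeat first | exact Or.inl (by omega) | refine Or.inr ?_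
      try omega

/-! ### The burning number -/

/-- With an empty third path the only listed exception is the pair (2, 0) at deficit 0: 2 is not a
sum of distinct odd numbers. -/
theorem coverable_two_paths {m x y : ℕ} (hs : x + y ≤ m ^ 2)
    (hE : ¬ (x + y = m ^ 2 ∧ (x = 2 ∨ y = 2))) : Coverable m 0 x y := by
  have hne : ∀ a b, a + b = x + y → (b = 2 → x = 2 ∨ y = 2) → ¬ Exceptional m a b 0 := by
    rintro a b hab hb (h | ⟨s, -, h, hp⟩ | hp)
    · omega
    · simp only [PairExceptional, List.mem_cons, Prod.mk.injEq, List.not_mem_nil, or_false] at hp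
      exact hE ⟨by omega, hb (by omega)⟩
    · simp only [SporadicExceptional, List.mem_cons, Prod.mk.injEq, List.not_mem_nil,
        or_false] at hp
      omega
  rcases le_total y x with h | h
  · exact (coverable_of_not_exceptional (Nat.zero_le _) h hs
      (hne x y rfl fun h => Or.inr h)).rotate.rotate
  · exact (coverable_of_not_exceptional (Nat.zero_le _) h (by omega)
      (hne y x (by omega) fun h => Or.inl h)).swap.rotate.rotate

namespace unicyclicGraph

theorem isBurnable_of_short_cycle {g a₁ a₂ m r : ℕ} (hg : 3 ≤ g) (ha : a₂ ≤ a₁)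
    (hn : g + a₁ + a₂ = (m + 1) ^ 2 + r) (hrg : r + 1 ≤ g) (hgm : g ≤ 2 * m + 1)
    (ha₁ : a₁ + g / 2 + 1 ≤ (m + 1) ^ 2)
    (hB : ((g : ℤ), (a₁ : ℤ), (a₂ : ℤ)) ∉ exceptB ((m + 1 : ℕ) : ℤ)) :
    IsBurnable (unicyclicGraph g a₁ a₂) (m + 1) := by
  have hsq : (m + 1) ^ 2 = m ^ 2 + 2 * m + 1 := by ring
  have hcases : m = 1 ∨ m = 2 ∨ (3 ≤ m ∧ 9 ≤ m ^ 2) := by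
    rcases Nat.lt_or_ge m 3 with h | h
    · omega
    · exact Or.inr (Or.inr ⟨h, Nat.pow_le_pow_left h 2⟩)
  have hm2 : m ^ 2 ≠ 2 := by
    rcases hcases with rfl | rfl | h <;> omega
  rcases Nat.lt_or_ge a₂ m with h₂ | h₂
  · rcases Nat.lt_or_ge m a₁ with h₁ | h₁
    · refine isBurnable_of_coverable hg (d := min (m - g / 2) (m - a₂)) (by omega) (by omega) ?_
      rw [show g - (2 * (m - min (m - g / 2) (m - a₂)) + 1) = 0 by omega,
        show a₂ - (m - min (m - g / 2) (m - a₂)) = 0 by omega]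
      exact coverable_two_paths (by omega) (by omega)
    · refine isBurnable_of_coverable hg (d := 0) (by omega) (by omega) ?_
      rw [show g - (2 * (m - 0) + 1) = 0 by omega]
      exact coverable_two_paths (by omega) (by omega)
  · by_cases hE : a₁ - m + (a₂ - m) = m ^ 2 ∧ (a₁ - m = 2 ∨ a₂ - m = 2)
    · have h₃ : a₂ - m = 2 ∧ a₁ - m + 2 = m ^ 2 := by
        rcases hcases with rfl | rfl | h <;> omega
      -- The two longer cycles, g = 2m and g = 2m + 1, are exactly those in `exceptB`. Otherwise the
      -- shift d = 1 still swallows the cycle and turns the lengths (m² - 2, 2) into (m² - 3, 3),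
      -- which is harmless since m² ≠ 5.
      have hg' : g + 1 ≤ 2 * m := by
        by_contra hcon
        refine hB ?_
        have hsq' : ((m : ℤ) + 1) ^ 2 = ((m ^ 2 : ℕ) : ℤ) + 2 * m + 1 := by push_cast; ring
        simp only [exceptB, Set.mem_insert_iff, Set.mem_singleton_iff, Prod.mk.injEq,
          Nat.cast_add, Nat.cast_one, hsq']
        clear hcases
        generalize m ^ 2 = M at *
        omega
      have hm5 : m ^ 2 ≠ 5 ∧ 4 ≤ m ^ 2 := by
        rcases hcases with rfl | rfl | h <;> omega
      refine isBurnable_of_coverable hg (d := 1) (by omega) (by omega) ?_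
      rw [show g - (2 * (m - 1) + 1) = 0 by omega]
      exact coverable_two_paths (by omega) (by omega)
    · refine isBurnable_of_coverable hg (d := 0) (by omega) (by omega) ?_
      rw [show g - (2 * (m - 0) + 1) = 0 by omega]
      exact coverable_two_paths (by omega) hE

theorem isBurnable_of_long_cycle {g a₁ a₂ m r : ℕ} (hg : 3 ≤ g) (ha : a₂ ≤ a₁)
    (hn : g + a₁ + a₂ = (m + 1) ^ 2 + r) (hr : r ≤ 2 * m) (hgm : 2 * (m + 1) ≤ g)
    (hgq : g ≤ (m + 1) ^ 2) (ha₂ : r ≤ a₂ + m)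
    (hC : ((g : ℤ), (a₁ : ℤ), (a₂ : ℤ)) ∉ exceptC ((m + 1 : ℕ) : ℤ) r) :
    IsBurnable (unicyclicGraph g a₁ a₂) (m + 1) := by
  have hsq : (m + 1) ^ 2 = m ^ 2 + 2 * m + 1 := by ring
  have hs : g - (2 * m + 1) + (a₁ - m) + (a₂ - m) ≤ m ^ 2 := by omega
  have hub : Coverable m (g - (2 * m + 1)) (a₁ - m) (a₂ - m) →
      IsBurnable (unicyclicGraph g a₁ a₂) (m + 1) := fun h =>
    isBurnable_of_coverable hg (d := 0) (by omega) (by omega) h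
  rcases Nat.lt_or_ge (g - (2 * m + 1)) (a₁ - m) with h₁ | h₁
  · rcases Nat.lt_or_ge (g - (2 * m + 1)) (a₂ - m) with h₂ | h₂
    · refine hub (coverable_of_not_exceptional h₂.le (by omega) (by omega) fun hE => ?_).rotate.rotate
      exact hC (mem_exceptC_of_cycle_shortest hgm hn (by omega) h₂ hE)
    · by_cases hE : Exceptional m (a₁ - m) (g - (2 * m + 1)) (a₂ - m)
      · obtain ⟨hx, hz, hy⟩ :=
          (mem_exceptC_of_cycle_middle hgm hn h₁.le h₂ hE).resolve_left hC
        have hm : 4 ≤ m := by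
          by_contra h
          have : m ^ 2 ≤ 3 ^ 2 := Nat.pow_le_pow_left (by omega) 2
          omega
        have hm2 : 16 ≤ m ^ 2 := by nlinarith
        -- The shift gives lengths m² - 8, 4 or 5, and 3, with deficit 1 or 0 respectively; neither
        -- is listed.
        refine isBurnable_of_coverable hg (d := 1) (by omega) (by omega) ?_
        rw [show a₂ - (m - 1) = 3 by omega]
        refine (coverable_of_not_exceptional (by omega) (by omega) (by omega) ?_).swap
        rintro (h | ⟨s, -, h, hp⟩ | hp)
        · omega
        · simp only [PairExceptional, List.mem_cons, Prod.mk.injEq, List.not_mem_nil,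
            or_false] at hp
          omega
        · simp only [SporadicExceptional, List.mem_cons, Prod.mk.injEq, List.not_mem_nil,
            or_false] at hp
          omega
      · exact hub (coverable_of_not_exceptional h₂ h₁.le (by omega) hE).swap
  · by_cases hE : Exceptional m (g - (2 * m + 1)) (a₁ - m) (a₂ - m)
    · obtain ⟨hy, hz, hx⟩ :=
        (mem_exceptC_of_cycle_longest hgm hn h₁ (by omega) hE).resolve_left hC
      have hm : 3 ≤ m := by
        by_contra h
        have : m ^ 2 ≤ 2 ^ 2 := Nat.pow_le_pow_left (by omega) 2
        omega
      have hm2 : 9 ≤ m ^ 2 := by nlinarith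
      -- The shift turns both arm remainders 2, 2 into 1, 3 and lengthens the cycle remainder by 2;
      -- the pair (3, 1) is not listed.
      refine isBurnable_of_coverable hg (d := 1) (by omega) (by omega) ?_
      rw [show a₂ - (m - 1) = 3 by omega, show a₁ - (m + 1) = 1 by omega]
      refine (coverable_of_not_exceptional (y := 3) (z := 1) (by omega) (by omega)
        (by omega) ?_).swap.rotate
      rintro (h | ⟨s, -, h, hp⟩ | hp)
      · omega
      · simp only [PairExceptional, List.mem_cons, Prod.mk.injEq, List.not_mem_nil,
          or_false] at hp
        omega
      · simp only [SporadicExceptional, List.mem_cons, Prod.mk.injEq, List.not_mem_nil,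
          or_false] at hp
        omega
    · exact hub (coverable_of_not_exceptional (by omega) h₁ hs hE)

end unicyclicGraph

theorem ceil_sqrt_sub_one {q r : ℕ} (hr : 1 ≤ r) (hrq : r ≤ 2 * q + 1) :
    ⌈Real.sqrt ((q ^ 2 + r : ℕ) : ℝ)⌉ - 1 = (q : ℤ) := by
  have h : ⌈Real.sqrt ((q ^ 2 + r : ℕ) : ℝ)⌉ = (q : ℤ) + 1 := by
    have h₁ : (1 : ℝ) ≤ r := by exact_mod_cast hr
    have h₂ : (r : ℝ) ≤ 2 * q + 1 := by exact_mod_cast hrq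
    rw [Int.ceil_eq_iff]
    push_cast
    constructor
    · rw [add_sub_cancel_right]
      exact Real.lt_sqrt_of_sq_lt (by linarith)
    · exact Real.sqrt_le_iff.2 ⟨by positivity, by nlinarith⟩
  omega

theorem theorem4p3 (g a₁ a₂ n q r : ℕ) (hg : 3 ≤ g) (ha₂ : 1 ≤ a₂) (ha : a₂ ≤ a₁)
    (hn : n = Fintype.card (Fin g ⊕ Fin a₁ ⊕ Fin a₂)) (hnq : n = q ^ 2 + r)
    (hr : 1 ≤ r) (hrq : (r : ℤ) ≤ 2 * q - 2)
    (h : (r + 1 ≤ g ∧ (g : ℤ) ≤ 2 * q - 1 ∧ (a₁ : ℤ) ≤ (q : ℤ) ^ 2 - (g : ℤ) / 2 - 1 ∧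
            ((g : ℤ), (a₁ : ℤ), (a₂ : ℤ)) ∉ exceptB q) ∨
         (2 * q ≤ g ∧ g ≤ q ^ 2 ∧ (a₂ : ℤ) ≥ (r : ℤ) - q + 1 ∧
            ((g : ℤ), (a₁ : ℤ), (a₂ : ℤ)) ∉ exceptC q r)) :
    (burningNumber (unicyclicGraph g a₁ a₂) : ℤ) = ⌈Real.sqrt n⌉ - 1 ∧
      ⌈Real.sqrt n⌉ - 1 = (q : ℤ) := by
  have hceil : ⌈Real.sqrt n⌉ - 1 = (q : ℤ) := by
    rw [hnq]
    exact ceil_sqrt_sub_one hr (by omega)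
  refine ⟨?_, hceil⟩
  rw [hceil]
  simp only [Fintype.card_sum, Fintype.card_fin] at hn
  obtain ⟨m, rfl⟩ : ∃ m, q = m + 1 := ⟨q - 1, by omega⟩
  have hsum : g + a₁ + a₂ = (m + 1) ^ 2 + r := by omega
  have hburn : IsBurnable (unicyclicGraph g a₁ a₂) (m + 1) := by
    rcases h with ⟨h₁, h₂, h₃, h₄⟩ | ⟨h₁, h₂, h₃, h₄⟩
    · refine unicyclicGraph.isBurnable_of_short_cycle hg ha hsum h₁ (by omega) ?_ h₄
      zify
      push_cast at h₃
      linarith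
    · exact unicyclicGraph.isBurnable_of_long_cycle hg ha hsum (by omega) h₁ h₂ (by omega) h₄
  have hle : burningNumber (unicyclicGraph g a₁ a₂) ≤ m + 1 := Nat.sInf_le hburn
  have hge : m + 1 ≤ burningNumber (unicyclicGraph g a₁ a₂) :=
    le_csInf ⟨_, hburn⟩ fun k hk => unicyclicGraph.le_of_isBurnable hg (by omega) hk
  exact_mod_cast le_antisymm hle hge
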